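/- Let $n$ be a positive integer, $[n]=\{1,\dots,n\}$ and $[\pm n]=\{\pm1,\dots,\pm n\}$. Let $S_n^B$ be the group of signed permutations, i.e. of the permutations $\sigma$ of $[\pm n]$ with $\sigma(-i)=-\sigma(i)$ for all $i$. Let $s_0\in S_n^B$ be the element that exchanges $1$ and $-1$ and fixes everything else, and for $1\le i\le n-1$ let $s_i\in S_n^B$ be the element that exchanges $i$ and $i+1$, exchanges $-i$ and $-(i+1)$, and fixes everything else. For $\sigma\in S_n^B$ put: - $\ell(\sigma)$, the length of $\sigma$: the least $k\ge 0$ such that $\sigma=s_{a_1}\cdots s_{a_k}$ for some $a_1,\dots,a_k\in\{0,\dots,n-1\}$; - $\mathrm{inv}(\sigma)=|\{(i,j)\in[n]^2: i<j,\ \sigma(i)>\sigma(j)\}|+|\{(i,j)\in[n]^2: i\le j,\ \sigma(-i)>\sigma(j)\}|$; - $\mathrm{wex}(\sigma)=|\{i\in[n]:\sigma(i)\ge i\}|$; - $\mathrm{al}_{nest}(\sigma)$, the number of pairs $(i,j)\in[n]^2$ with $-i<-j<-\sigma(j)<-\sigma(i)$, or $-i<j\le\sigma(j)<-\sigma(i)$,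 or $i<j\le\sigma(j)<\sigma(i)$; - $\mathrm{crs}(\sigma)$, the number of pairs $(i,j)\in[n]^2$ with $i<j\le\sigma(i)<\sigma(j)$, or $-i<-j<-\sigma(i)<-\sigma(j)$, or $-i<j\le-\sigma(i)<\sigma(j)$. Then for every $\sigma\in S_n^B$, $$\ell(\sigma)=\mathrm{inv}(\sigma)=2\,\mathrm{al}_{nest}(\sigma)+\mathrm{crs}(\sigma)+n-\mathrm{wex}(\sigma).$$ -/

import Mathlib

/-- The set `[±n] = {±1, …, ±n}` of integers. -/
noncomputable def SignedSet (n : ℕ) : Finset ℤ := (Finset.Icc (-(n : ℤ)) n).erase 0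

namespace SignedSet

theorem mem_iff {n : ℕ} {k : ℤ} : k ∈ SignedSet n ↔ k ≠ 0 ∧ -(n : ℤ) ≤ k ∧ k ≤ n := by
  simp [SignedSet]

/-- Negation `i ↦ -i` on `[±n]`. -/
noncomputable instance (n : ℕ) : InvolutiveNeg (SignedSet n) where
  neg i := ⟨-i.1, by have h := mem_iff.1 i.2; rw [mem_iff]; omega⟩
  neg_neg i := Subtype.ext (neg_neg i.1)

theorem coe_neg {n : ℕ} (i : SignedSet n) : ((-i : SignedSet n) : ℤ) = -(i : ℤ) := rfl

/-- The positive part `[n] = {1, …, n}` of `[±n]`. -/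
noncomputable def positives (n : ℕ) : Finset (SignedSet n) := Finset.univ.filter fun i => 0 < (i : ℤ)

/-- The element `k + 1` of `[n]`, for `k = 0, …, n - 1`. -/
noncomputable def ofFin {n : ℕ} (k : Fin n) : SignedSet n :=
  ⟨(k : ℤ) + 1, by rw [mem_iff]; omega⟩

end SignedSet

/-- The group `S_n^B` of signed permutations: the permutations `σ` of `[±n]` such that
`σ(-i) = -σ(i)`. -/
def SignedPerm (n : ℕ) : Subgroup (Equiv.Perm (SignedSet n)) where
  carrier := {σ | ∀ i, σ (-i) = -σ i}
  mul_mem' {σ τ} hσ hτ i := by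
    rw [Equiv.Perm.mul_apply, Equiv.Perm.mul_apply, hτ i, hσ (τ i)]
  one_mem' _ := rfl
  inv_mem' {σ} hσ i := by
    rw [Equiv.Perm.inv_eq_iff_eq, hσ (σ⁻¹ i), ← Equiv.Perm.mul_apply, mul_inv_cancel]
    rfl

namespace SignedPerm

open SignedSet

theorem swap_mem {n : ℕ} (a : SignedSet n) : Equiv.swap a (-a) ∈ SignedPerm n := by
  intro i
  simp only [Equiv.swap_apply_def, Subtype.ext_iff, coe_neg]
  split_ifs <;> (try simp only [coe_neg]) <;> omega

theorem swap_mul_swap_mem {n : ℕ} (a b : SignedSet n) (ha : 0 < (a : ℤ)) (hb : 0 < (b : ℤ)) :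
    Equiv.swap a b * Equiv.swap (-a) (-b) ∈ SignedPerm n := by
  intro i
  simp only [Equiv.Perm.mul_apply, Equiv.swap_apply_def, Subtype.ext_iff]
  split_ifs <;> simp_all only [coe_neg] <;> grind

/-- The generators `s_0, …, s_{n-1}` of the Coxeter system of type `B`: `s_0` exchanges `1` and
`-1`; for `i ≥ 1`, `s_i` exchanges `i` and `i + 1` (and hence also `-i` and `-(i + 1)`). All other
elements are fixed. -/
noncomputable def gen {n : ℕ} (i : Fin n) : SignedPerm n :=
  if (i : ℕ) = 0 then
    ⟨Equiv.swap (ofFin i) (-ofFin i), swap_mem _⟩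
  else
    let a : SignedSet n := ofFin ⟨(i : ℕ) - 1, by omega⟩
    let b : SignedSet n := ofFin i
    ⟨Equiv.swap a b * Equiv.swap (-a) (-b),
      swap_mul_swap_mem a b (by simp only [a, ofFin]; omega) (by simp only [b, ofFin]; omega)⟩

variable {n : ℕ}

/-- The length `ℓ(σ)`: the minimum of the `k` such that `σ = s_{a_1} ⋯ s_{a_k}`. -/
noncomputable def length (σ : SignedPerm n) : ℕ :=
  sInf {k | ∃ w : List (Fin n), w.length = k ∧ (w.map gen).prod = σ}

/-- The inversion number `inv(σ)`: the number of pairs in `[n] × [n]` with `i < j` and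
`σ(i) > σ(j)`, plus the number of pairs with `i ≤ j` and `σ(-i) > σ(j)`. A pair that satisfies both
conditions is counted twice. -/
noncomputable def inv (σ : SignedPerm n) : ℕ :=
  ((positives n ×ˢ positives n).filter fun (i, j) => i < j ∧ σ.1 i > σ.1 j).card +
  ((positives n ×ˢ positives n).filter fun (i, j) => i ≤ j ∧ σ.1 (-i) > σ.1 j).card

/-- The number `wex(σ)` of weak excedances, that is, of `i ∈ [n]` with `σ(i) ≥ i`. -/
noncomputable def wex (σ : SignedPerm n) : ℕ :=
  ((positives n).filter fun i => σ.1 i ≥ i).card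

/-- The set `A_nest(σ)` of nestings (alignments of nested type). -/
noncomputable def nestings (σ : SignedPerm n) : Finset (SignedSet n × SignedSet n) :=
  (positives n ×ˢ positives n).filter fun (i, j) =>
    (-i < -j ∧ -j < -σ.1 j ∧ -σ.1 j < -σ.1 i) ∨
    (-i < j ∧ j ≤ σ.1 j ∧ σ.1 j < -σ.1 i) ∨
    (i < j ∧ j ≤ σ.1 j ∧ σ.1 j < σ.1 i)

/-- The number `al_nest(σ)` of nestings. -/
noncomputable def alNest (σ : SignedPerm n) : ℕ := (nestings σ).card

/-- The set `C(σ)` of crossings. -/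
noncomputable def crossings (σ : SignedPerm n) : Finset (SignedSet n × SignedSet n) :=
  (positives n ×ˢ positives n).filter fun (i, j) =>
    (i < j ∧ j ≤ σ.1 i ∧ σ.1 i < σ.1 j) ∨
    (-i < -j ∧ -j < -σ.1 i ∧ -σ.1 i < -σ.1 j) ∨
    (-i < j ∧ j ≤ -σ.1 i ∧ -σ.1 i < σ.1 j)

/-- The number `crs(σ)` of crossings. -/
noncomputable def crs (σ : SignedPerm n) : ℕ := (crossings σ).card

end SignedPerm

/-! ### Counts over `[n]` as sums over `Fin n` -/

namespace SignedSet

variable {n : ℕ}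

/-! The two equalities are independent. For the formula, sum `pairDefect` over all ordered pairs of
positions. It is twice `inv - 2 al_nest - crs`, plus correction terms comparing how many positions
and how many values `|σ(l)|` lie below a cut. Since `|σ|` permutes `[n]`, the corrections have known
sums (`sum_cut_position`, `sum_cut_value`). They make the contribution antisymmetric in the two
positions (`pairDefect_add_swap`), so only the diagonal survives, and `pairDefect_self` shows that
it counts the non-weak-excedances. For the length, right multiplication by a generator changes `inv`
by exactly one (`windowInv_comp_swap`, `windowInv_neg_first`), and only the identity has no
generator lowering `inv` (`eq_one_of_forall_inv_le`). -/

theorem coe_ofFin (k : Fin n) : ((ofFin k : SignedSet n) : ℤ) = (k : ℤ) + 1 := rfl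

theorem ofFin_injective : Function.Injective (ofFin : Fin n → SignedSet n) := by
  intro a b h
  have := congrArg Subtype.val h
  simp only [coe_ofFin] at this
  exact Fin.ext (by omega)

theorem exists_ofFin_eq {i : SignedSet n} (hi : 0 < (i : ℤ)) : ∃ k : Fin n, ofFin k = i := by
  have h := mem_iff.1 i.2
  exact ⟨⟨((i : ℤ) - 1).toNat, by omega⟩, Subtype.ext (by simp only [coe_ofFin]; omega)⟩

theorem positives_eq_map :
    positives n = Finset.univ.map ⟨(ofFin : Fin n → SignedSet n), ofFin_injective⟩ := by
  ext i
  simp only [positives, Finset.mem_filter, Finset.mem_univ, true_and, Finset.mem_map,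
    Function.Embedding.coeFn_mk]
  refine ⟨exists_ofFin_eq, ?_⟩
  rintro ⟨k, rfl⟩
  rw [coe_ofFin]
  omega

theorem card_filter_positives (p : SignedSet n → Prop) [DecidablePred p]
    (q : Fin n → Prop) [DecidablePred q] (h : ∀ k, p (ofFin k) ↔ q k) :
    (((positives n).filter p).card : ℤ) = ∑ k : Fin n, if q k then (1 : ℤ) else 0 := by
  rw [Finset.card_filter, positives_eq_map, Finset.sum_map]
  push_cast
  exact Finset.sum_congr rfl fun k _ => if_congr (h k) rfl rfl

theorem card_filter_positives_product (p : SignedSet n × SignedSet n → Prop) [DecidablePred p]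
    (q : Fin n → Fin n → Prop) [∀ k l, Decidable (q k l)]
    (h : ∀ k l, p (ofFin k, ofFin l) ↔ q k l) :
    (((positives n ×ˢ positives n).filter p).card : ℤ) =
      ∑ k : Fin n, ∑ l : Fin n, if q k l then (1 : ℤ) else 0 := by
  rw [Finset.card_filter, Finset.sum_product, positives_eq_map, Finset.sum_map]
  push_cast
  refine Finset.sum_congr rfl fun k _ => ?_
  rw [Finset.sum_map]
  exact Finset.sum_congr rfl fun l _ => if_congr (h k l) rfl rfl

end SignedSet

/-! ### Window notation -/

namespace SignedPerm

open SignedSet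

variable {n : ℕ}

/-- The window notation `σ(1), …, σ(n)` of a signed permutation, indexed from `0`. -/
noncomputable def window (σ : SignedPerm n) (k : Fin n) : ℤ := (σ.1 (ofFin k) : ℤ)

theorem apply_neg (σ : SignedPerm n) (i : SignedSet n) : σ.1 (-i) = -σ.1 i := σ.2 i

theorem coe_apply_neg_ofFin (σ : SignedPerm n) (k : Fin n) :
    (σ.1 (-ofFin k) : ℤ) = -window σ k := by
  rw [apply_neg, coe_neg, window]

theorem window_bounds (σ : SignedPerm n) (k : Fin n) :
    window σ k ≠ 0 ∧ -(n : ℤ) ≤ window σ k ∧ window σ k ≤ n :=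
  mem_iff.1 (σ.1 (ofFin k)).2

theorem abs_window_injective (σ : SignedPerm n) :
    Function.Injective fun k => |window σ k| := by
  intro a b h
  rcases abs_eq_abs.1 h with h | h
  · exact ofFin_injective (σ.1.injective (Subtype.ext h))
  · rw [← coe_apply_neg_ofFin] at h
    have := congrArg Subtype.val (σ.1.injective (Subtype.ext h))
    rw [coe_neg, coe_ofFin, coe_ofFin] at this
    omega

theorem window_injective : Function.Injective (window : SignedPerm n → Fin n → ℤ) := by
  intro σ τ h
  have hpos : ∀ k : Fin n, σ.1 (ofFin k) = τ.1 (ofFin k) := fun k => Subtype.ext (congrFun h k)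
  refine Subtype.ext (Equiv.ext fun i => ?_)
  have hi := mem_iff.1 i.2
  rcases lt_or_gt_of_ne hi.1 with h0 | h0
  · obtain ⟨k, hk⟩ := exists_ofFin_eq (i := -i) (by rw [coe_neg]; omega)
    have := hpos k
    rw [hk, apply_neg, apply_neg] at this
    exact neg_injective this
  · obtain ⟨k, rfl⟩ := exists_ofFin_eq h0
    exact hpos k

/-- `|σ|` permutes `[n]`. -/
theorem sum_abs_window (σ : SignedPerm n) (F : ℤ → ℤ) :
    ∑ k : Fin n, F |window σ k| = ∑ k : Fin n, F ((k : ℤ) + 1) := by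
  have hlt : ∀ k : Fin n, (|window σ k| - 1).toNat < n := fun k => by
    have := window_bounds σ k
    rcases abs_cases (window σ k) with h | h <;> omega
  have hval : ∀ k : Fin n, (((|window σ k| - 1).toNat : ℕ) : ℤ) + 1 = |window σ k| := fun k => by
    have := window_bounds σ k
    rcases abs_cases (window σ k) with h | h <;> omega
  let f : Fin n → Fin n := fun k => ⟨(|window σ k| - 1).toNat, hlt k⟩
  have hf : Function.Bijective f := Finite.injective_iff_bijective.1 fun a b h => by
    apply abs_window_injective σ
    have := congrArg Fin.val h
    simp only [f] at this
    simp only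
    rw [← hval a, ← hval b, this]
  rw [← hf.sum_comp fun k => F ((k : ℤ) + 1)]
  exact Finset.sum_congr rfl fun k _ => by simp only [f]; rw [hval]

/-! ### The inversion number in terms of nestings and crossings -/

theorem inv_eq_sum (σ : SignedPerm n) :
    (inv σ : ℤ) = ∑ k : Fin n, ∑ l : Fin n,
      ((if (k : ℤ) < l ∧ window σ l < window σ k then 1 else 0) +
        (if (k : ℤ) ≤ l ∧ window σ l < -window σ k then 1 else 0)) := by
  simp only [Finset.sum_add_distrib]
  rw [inv, Nat.cast_add]
  congr 1 <;> refine card_filter_positives_product _ _ fun k l => ?_ <;>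
    simp only [gt_iff_lt, ← Subtype.coe_lt_coe, ← Subtype.coe_le_coe, coe_apply_neg_ofFin,
      coe_ofFin] <;>
    simp only [window] <;> omega

theorem wex_eq_sum (σ : SignedPerm n) :
    (wex σ : ℤ) = ∑ k : Fin n, if (k : ℤ) + 1 ≤ window σ k then 1 else 0 :=
  card_filter_positives _ _ fun _ => Iff.rfl

/-- For positive positions `-i < j` is automatic, so it disappears from the middle clause; the same
happens in `crs_eq_sum`. -/
theorem alNest_eq_sum (σ : SignedPerm n) :
    (alNest σ : ℤ) = ∑ k : Fin n, ∑ l : Fin n,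
      if ((l : ℤ) < k ∧ window σ l < l + 1 ∧ window σ k < window σ l) ∨
        ((l : ℤ) + 1 ≤ window σ l ∧ window σ l < -window σ k) ∨
        ((k : ℤ) < l ∧ (l : ℤ) + 1 ≤ window σ l ∧ window σ l < window σ k) then 1 else 0 := by
  refine card_filter_positives_product _ _ fun k l => ?_
  simp only [← Subtype.coe_lt_coe, ← Subtype.coe_le_coe, coe_neg, coe_ofFin]
  simp only [window]
  omega

theorem crs_eq_sum (σ : SignedPerm n) :
    (crs σ : ℤ) = ∑ k : Fin n, ∑ l : Fin n,
      if ((k : ℤ) < l ∧ (l : ℤ) + 1 ≤ window σ k ∧ window σ k < window σ l) ∨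
        ((l : ℤ) < k ∧ window σ k < l + 1 ∧ window σ l < window σ k) ∨
        ((l : ℤ) + 1 ≤ -window σ k ∧ -window σ k < window σ l) then 1 else 0 := by
  refine card_filter_positives_product _ _ fun k l => ?_
  simp only [← Subtype.coe_lt_coe, ← Subtype.coe_le_coe, coe_neg, coe_ofFin]
  simp only [window]
  omega

end SignedPerm

/-! ### Antisymmetry of the corrected pair contribution -/

namespace SignedPerm

variable {n : ℕ}

/-- The contribution of an ordered pair of positions `i`, `j` with values `x`, `y` to twice the
difference between the inversion number and `2 al_nest + crs`, corrected by cut-counting terms whose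
sum over `j` is known. -/
def pairDefect (i j x y : ℤ) : ℤ :=
  2 * ((if i < j ∧ y < x then 1 else 0) + (if i ≤ j ∧ y < -x then 1 else 0)) -
  4 * (if (j < i ∧ y < j + 1 ∧ x < y) ∨ (j + 1 ≤ y ∧ y < -x) ∨ (i < j ∧ j + 1 ≤ y ∧ y < x)
    then 1 else 0) -
  2 * (if (i < j ∧ j + 1 ≤ x ∧ x < y) ∨ (j < i ∧ x < j + 1 ∧ y < x) ∨ (j + 1 ≤ -x ∧ -x < y)
    then 1 else 0) -
  (if x < i + 1 then 1 else -1) *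
    ((if j + 1 < i + 1 then 1 else 0) - (if |y| < i + 1 then 1 else 0)) +
  (if 0 < x ∧ x < i + 1 then -1 else 1) *
    ((if j + 1 ≤ |x| then 1 else 0) - (if |y| < |x| then 1 else 0))

/-- The trailing sign is the weight of the value cut, whose sum over `j` is 1, so it cancels in
`inv_eq`. -/
theorem pairDefect_self {i x : ℤ} (hi : 0 ≤ i) (hx : x ≠ 0) :
    pairDefect i i x x =
      2 * (1 - if i + 1 ≤ x then 1 else 0) + (if 0 < x ∧ x < i + 1 then -1 else 1) := by
  unfold pairDefect
  rcases abs_cases x with ⟨h, h'⟩ | ⟨h, h'⟩ <;> rw [h] <;>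
  rcases lt_or_ge x (i + 1) with h1 | h1 <;> rcases lt_or_ge (-x) (i + 1) with h2 | h2 <;>
  (try omega) <;>
  simp (disch := omega) only [if_pos, if_neg] <;> norm_num

/-- The cut terms are essential: for `s_1` and positions 1, 2 the uncorrected sum is 2. -/
theorem pairDefect_add_swap_of_lt {i j x y : ℤ} (hi : 0 ≤ i) (hij : i < j) (hx : x ≠ 0)
    (hy : y ≠ 0) (hxy : |x| ≠ |y|) : pairDefect i j x y + pairDefect j i y x = 0 := by
  unfold pairDefect
  revert hxy
  rcases abs_cases x with ⟨h, h'⟩ | ⟨h, h'⟩ <;> rw [h] <;>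
  rcases abs_cases y with ⟨k, k'⟩ | ⟨k, k'⟩ <;> rw [k] <;> intro hxy <;>
  -- Every indicator depends only on the signs of `x`, `y` and the relative order of `i + 1`, `j +
  -- 1`, `|x|`, `|y|`, so this is a finite check; `omega` discards impossible orders.
  rcases lt_or_ge |x| (i + 1) with h1 | h1 <;> rcases lt_or_ge |x| (j + 1) with h2 | h2 <;>
  rcases lt_or_ge |y| (i + 1) with k1 | k1 <;> rcases lt_or_ge |y| (j + 1) with k2 | k2 <;>
  rcases lt_or_ge |x| |y| with l | l <;> rw [h] at * <;> rw [k] at * <;>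
  (try omega) <;>
  simp (disch := omega) only [if_pos, if_neg] <;> norm_num

theorem pairDefect_add_swap {i j x y : ℤ} (hi : 0 ≤ i) (hj : 0 ≤ j) (hij : i ≠ j) (hx : x ≠ 0)
    (hy : y ≠ 0) (hxy : |x| ≠ |y|) : pairDefect i j x y + pairDefect j i y x = 0 := by
  rcases lt_or_gt_of_ne hij with h | h
  · exact pairDefect_add_swap_of_lt hi h hx hy hxy
  · rw [add_comm]
    exact pairDefect_add_swap_of_lt hj h hy hx hxy.symm

end SignedPerm

theorem Finset.sum_sum_eq_sum_diag_of_antisymm {ι : Type*} [Fintype ι] (G : ι → ι → ℤ)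
    (h : ∀ i j, i ≠ j → G i j + G j i = 0) : ∑ i, ∑ j, G i j = ∑ i, G i i := by
  classical
  have hsum : ∑ i, ∑ j, (G i j + G j i) = ∑ i, (G i i + G i i) :=
    Finset.sum_congr rfl fun i _ =>
      Finset.sum_eq_single i (fun j _ hj => h i j hj.symm) (by simp)
  simp only [Finset.sum_add_distrib] at hsum
  rw [Finset.sum_comm (f := fun i j => G j i)] at hsum
  omega

/-! ### Summation over all pairs -/

namespace SignedPerm

variable {n : ℕ}

theorem sum_cut_position (σ : SignedPerm n) (k : Fin n) :
    ∑ l : Fin n, ((if (l : ℤ) + 1 < k + 1 then (1 : ℤ) else 0) -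
      (if |window σ l| < (k : ℤ) + 1 then 1 else 0)) = 0 := by
  rw [Finset.sum_sub_distrib, sum_abs_window σ fun t => if t < (k : ℤ) + 1 then 1 else 0, sub_self]

/-- The weak and strict counts of `|σ|` at the cut differ only at `l = k`. -/
theorem sum_cut_value (σ : SignedPerm n) (k : Fin n) :
    ∑ l : Fin n, ((if (l : ℤ) + 1 ≤ |window σ k| then (1 : ℤ) else 0) -
      (if |window σ l| < |window σ k| then 1 else 0)) = 1 := by
  rw [Finset.sum_sub_distrib, sum_abs_window σ fun t => if t < |window σ k| then 1 else 0,
    ← sum_abs_window σ fun t => if t ≤ |window σ k| then 1 else 0,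
    ← sum_abs_window σ fun t => if t < |window σ k| then 1 else 0, ← Finset.sum_sub_distrib,
    Finset.sum_eq_single k]
  · simp
  · intro l _ hl
    have : |window σ l| ≠ |window σ k| := fun h => hl (abs_window_injective σ h)
    rcases lt_or_gt_of_ne this with h | h
    · rw [if_pos h.le, if_pos h, sub_self]
    · rw [if_neg h.not_ge, if_neg h.not_gt, sub_self]
  · simp

theorem inv_eq (σ : SignedPerm n) :
    (inv σ : ℤ) = 2 * (alNest σ : ℤ) + (crs σ : ℤ) + (n : ℤ) - (wex σ : ℤ) := by
  have hdiag := Finset.sum_sum_eq_sum_diag_of_antisymm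
    (fun k l : Fin n => pairDefect k l (window σ k) (window σ l)) fun k l hkl =>
      pairDefect_add_swap (by omega) (by omega) (fun h => hkl (Fin.ext (by omega)))
        (window_bounds σ k).1 (window_bounds σ l).1 fun h => hkl (abs_window_injective σ h)
  have hself : ∑ k : Fin n, pairDefect k k (window σ k) (window σ k) = 2 * (n - wex σ) +
      ∑ k : Fin n, if 0 < window σ k ∧ window σ k < (k : ℤ) + 1 then (-1 : ℤ) else 1 := by
    rw [Finset.sum_congr rfl fun k _ => pairDefect_self (by omega) (window_bounds σ k).1,
      Finset.sum_add_distrib, ← Finset.mul_sum, Finset.sum_sub_distrib, wex_eq_sum]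
    simp
  have hall : ∑ k : Fin n, ∑ l : Fin n, pairDefect k l (window σ k) (window σ l) =
      2 * inv σ - 4 * alNest σ - 2 * crs σ +
      ∑ k : Fin n, if 0 < window σ k ∧ window σ k < (k : ℤ) + 1 then (-1 : ℤ) else 1 := by
    simp only [pairDefect]
    rw [inv_eq_sum, alNest_eq_sum, crs_eq_sum]
    simp only [Finset.mul_sum, ← Finset.sum_sub_distrib, ← Finset.sum_add_distrib]
    refine Finset.sum_congr rfl fun k _ => ?_
    rw [Finset.sum_add_distrib, Finset.sum_sub_distrib, ← Finset.mul_sum, ← Finset.mul_sum,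
      sum_cut_position, sum_cut_value]
    ring
  rw [hself, hall] at hdiag
  omega

end SignedPerm

namespace SignedPerm

open SignedSet

variable {n : ℕ}

/-! ### The length as the inversion number -/

/-- The number of ways in which the values `x`, `y`, read in this order, form an inversion. -/
def inversionWeight (x y : ℤ) : ℤ := (if y < x then 1 else 0) + (if x + y < 0 then 1 else 0)

/-- The inversion number of a window. -/
def windowInv (v : Fin n → ℤ) : ℤ :=
  ∑ k : Fin n, ∑ l : Fin n, (if k < l then inversionWeight (v k) (v l) else 0) +
    ∑ k : Fin n, if v k < 0 then 1 else 0

theorem inv_eq_windowInv (σ : SignedPerm n) : (inv σ : ℤ) = windowInv (window σ) := by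
  rw [inv_eq_sum, windowInv, ← Finset.sum_add_distrib]
  refine Finset.sum_congr rfl fun k _ => ?_
  -- The diagonal pairs of the second count are the negative entries.
  have hk : (if window σ k < 0 then (1 : ℤ) else 0) =
      ∑ l : Fin n, if k = l then (if window σ k < 0 then 1 else 0) else 0 := by simp
  rw [hk, ← Finset.sum_add_distrib]
  refine Finset.sum_congr rfl fun l _ => ?_
  rcases lt_trichotomy k l with h | rfl | h
  · have h' : (k : ℤ) < l := by exact_mod_cast h
    simp only [inversionWeight, h', h'.le, true_and, if_pos h, if_neg h.ne, add_zero,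
      lt_neg_iff_add_neg, add_comm (window σ l)]
  · simp only [lt_irrefl, false_and, le_refl, true_and, if_false, if_true, zero_add]
    exact if_congr (by omega) rfl rfl
  · have h' : (l : ℤ) < k := by exact_mod_cast h
    simp only [h'.not_gt, h'.not_ge, false_and, if_neg h.not_gt, if_neg h.ne', if_false, add_zero]

/-- Since the positions are adjacent, only the pair `(a, b)` changes its order, and the `x + y < 0`
part of its weight is symmetric. -/
theorem windowInv_comp_swap (v : Fin n → ℤ) {a b : Fin n} (hab : (b : ℕ) = a + 1) :
    windowInv (v ∘ Equiv.swap a b) =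
      windowInv v + (if v a < v b then 1 else 0) - (if v b < v a then 1 else 0) := by
  have hneg : ∑ k, (if (v ∘ Equiv.swap a b) k < 0 then (1 : ℤ) else 0) =
      ∑ k, if v k < 0 then 1 else 0 :=
    Equiv.sum_comp (Equiv.swap a b) fun k => if v k < 0 then (1 : ℤ) else 0
  have hreindex : ∑ k, ∑ l, (if k < l then
        inversionWeight ((v ∘ Equiv.swap a b) k) ((v ∘ Equiv.swap a b) l) else 0) =
      ∑ k, ∑ l, if Equiv.swap a b k < Equiv.swap a b l then inversionWeight (v k) (v l) else 0 := by
    rw [← Equiv.sum_comp (Equiv.swap a b)]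
    refine Finset.sum_congr rfl fun k _ => ?_
    rw [← Equiv.sum_comp (Equiv.swap a b)]
    exact Finset.sum_congr rfl fun l _ => by simp
  have hpoint : ∀ k l, (if Equiv.swap a b k < Equiv.swap a b l then
        inversionWeight (v k) (v l) else 0) =
      (if k < l then inversionWeight (v k) (v l) else 0) +
      (if k = b then if l = a then inversionWeight (v b) (v a) else 0 else 0) -
      (if k = a then if l = b then inversionWeight (v a) (v b) else 0 else 0) := by
    intro k l
    simp only [Equiv.swap_apply_def, Fin.ext_iff, Fin.lt_def]
    by_cases hka : k = a
    · by_cases hla : l = a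
      · subst hka hla; simp [hab]
      · by_cases hlb : l = b
        · subst hka hlb; simp [hab]
        · have : (l : ℕ) ≠ a := fun h => hla (Fin.ext h)
          have : (l : ℕ) ≠ b := fun h => hlb (Fin.ext h)
          subst hka
          simp (disch := omega) only [if_true, if_neg, add_zero, sub_zero]
          exact if_congr (by omega) rfl rfl
    · have : (k : ℕ) ≠ a := fun h => hka (Fin.ext h)
      by_cases hkb : k = b
      · subst hkb
        by_cases hla : l = a
        · subst hla; simp [hab]
        · have : (l : ℕ) ≠ a := fun h => hla (Fin.ext h)
          by_cases hlb : l = k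
          · subst hlb; simp [hab]
          · have : (l : ℕ) ≠ k := fun h => hlb (Fin.ext h)
            simp (disch := omega) only [if_true, if_neg, add_zero, sub_zero]
            exact if_congr (by omega) rfl rfl
      · have : (k : ℕ) ≠ b := fun h => hkb (Fin.ext h)
        simp (disch := omega) only [if_neg, add_zero, sub_zero]
        refine if_congr ?_ rfl rfl
        split_ifs <;> omega
  rw [windowInv, hneg, hreindex,
    Finset.sum_congr rfl fun k _ => Finset.sum_congr rfl fun l _ => hpoint k l, windowInv]
  simp only [Finset.sum_sub_distrib, Finset.sum_add_distrib, Finset.sum_ite_irrel,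
    Finset.sum_ite_eq', Finset.mem_univ, if_true, Finset.sum_const_zero]
  rw [inversionWeight, inversionWeight, add_comm (v b) (v a)]
  ring

/-- Negating the first entry of a pair exchanges the conditions `y < x` and `x + y < 0`, so only the
count of negative entries changes. -/
theorem windowInv_neg_first (v : Fin n → ℤ) {a : Fin n} (ha : (a : ℕ) = 0) (hv : v a ≠ 0) :
    windowInv (Function.update v a (-v a)) =
      windowInv v + (if 0 < v a then 1 else 0) - (if v a < 0 then 1 else 0) := by
  have hpair : ∀ k l, (if k < l then inversionWeight (Function.update v a (-v a) k)
        (Function.update v a (-v a) l) else 0) =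
      if k < l then inversionWeight (v k) (v l) else 0 := by
    intro k l
    split_ifs with hkl
    · have hl : l ≠ a := fun h => by rw [h, Fin.lt_def] at hkl; omega
      rw [Function.update_of_ne hl]
      by_cases hk : k = a
      · subst hk
        rw [Function.update_self, inversionWeight, inversionWeight, add_comm]
        exact congrArg₂ _ (if_congr (by omega) rfl rfl) (if_congr (by omega) rfl rfl)
      · rw [Function.update_of_ne hk]
    · rfl
  have hpoint : ∀ k, (if Function.update v a (-v a) k < 0 then (1 : ℤ) else 0) =
      (if v k < 0 then 1 else 0) +
        if k = a then (if 0 < v a then 1 else 0) - (if v a < 0 then 1 else 0) else 0 := by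
    intro k
    by_cases hk : k = a
    · subst hk
      rw [Function.update_self, if_pos rfl]
      split_ifs <;> omega
    · rw [Function.update_of_ne hk, if_neg hk, add_zero]
  simp only [windowInv, hpair, hpoint, Finset.sum_add_distrib, Finset.sum_ite_eq', Finset.mem_univ,
    if_true]
  ring

theorem window_mul_gen_zero (σ : SignedPerm n) {i : Fin n} (hi : (i : ℕ) = 0) :
    window (σ * gen i) = Function.update (window σ) i (-window σ i) := by
  funext k
  have h : window (σ * gen i) k = (σ.1 (Equiv.swap (ofFin i) (-ofFin i) (ofFin k)) : ℤ) := by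
    rw [gen, if_pos hi]; rfl
  rw [h]
  by_cases hk : k = i
  · subst hk
    rw [Equiv.swap_apply_left, Function.update_self, coe_apply_neg_ofFin]
  · rw [Function.update_of_ne hk, Equiv.swap_apply_of_ne_of_ne]
    · rfl
    · exact fun h => hk (ofFin_injective h)
    · intro h
      have := congrArg Subtype.val h
      rw [coe_neg, coe_ofFin, coe_ofFin] at this
      omega

theorem window_mul_gen_of_ne_zero (σ : SignedPerm n) {a i : Fin n} (hi : (i : ℕ) = a + 1) :
    window (σ * gen i) = window σ ∘ Equiv.swap a i := by
  funext k
  have ha : (⟨(i : ℕ) - 1, by omega⟩ : Fin n) = a := Fin.ext (by simp only; omega)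
  have h : window (σ * gen i) k = (σ.1 (Equiv.swap (ofFin a) (ofFin i)
      (Equiv.swap (-ofFin a) (-ofFin i) (ofFin k))) : ℤ) := by
    rw [gen, if_neg (by omega), ← ha]; rfl
  have hfix : ∀ b : Fin n, ofFin k ≠ -ofFin b := fun b h => by
    have := congrArg Subtype.val h
    rw [coe_neg, coe_ofFin, coe_ofFin] at this
    omega
  rw [h, Equiv.swap_apply_of_ne_of_ne (hfix _) (hfix _), ofFin_injective.swap_apply]
  rfl

theorem mul_gen_mul_gen (σ : SignedPerm n) (i : Fin n) : σ * gen i * gen i = σ := by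
  apply window_injective
  rcases Nat.eq_zero_or_pos (i : ℕ) with hi | hi
  · rw [window_mul_gen_zero _ hi, window_mul_gen_zero _ hi]
    simp
  · have hi' : (i : ℕ) = (⟨(i : ℕ) - 1, by omega⟩ : Fin n) + 1 := by simp only; omega
    rw [window_mul_gen_of_ne_zero _ hi', window_mul_gen_of_ne_zero _ hi', Function.comp_assoc]
    funext k
    simp

theorem inv_mul_gen_le (σ : SignedPerm n) (i : Fin n) : inv (σ * gen i) ≤ inv σ + 1 := by
  zify
  rw [inv_eq_windowInv, inv_eq_windowInv]
  rcases Nat.eq_zero_or_pos (i : ℕ) with hi | hi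
  · rw [window_mul_gen_zero _ hi, windowInv_neg_first _ hi (window_bounds σ i).1]
    split_ifs <;> omega
  · have hi' : (i : ℕ) = (⟨(i : ℕ) - 1, by omega⟩ : Fin n) + 1 := by simp only; omega
    rw [window_mul_gen_of_ne_zero _ hi', windowInv_comp_swap _ hi']
    split_ifs <;> omega

theorem window_one (k : Fin n) : window (1 : SignedPerm n) k = k + 1 := rfl

theorem inv_one : inv (1 : SignedPerm n) = 0 := by
  zify
  rw [inv_eq_sum]
  refine Finset.sum_eq_zero fun k _ => Finset.sum_eq_zero fun l _ => ?_
  rw [if_neg, if_neg, add_zero] <;> rw [window_one, window_one] <;> omega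

/-- Without descents, `0 < σ(1) < ⋯ < σ(n)`, hence `σ(k) ≥ k`; equality of the sums then forces
equality termwise. -/
theorem eq_one_of_forall_inv_le (σ : SignedPerm n)
    (h : ∀ i, inv (σ * gen i) + 1 ≠ inv σ) : σ = 1 := by
  have hzero : ∀ i : Fin n, (i : ℕ) = 0 → 0 < window σ i := fun i hi => by
    by_contra hneg
    have h0 := (window_bounds σ i).1
    apply h i
    zify
    rw [inv_eq_windowInv, inv_eq_windowInv, window_mul_gen_zero _ hi,
      windowInv_neg_first _ hi h0, if_neg hneg, if_pos (by omega)]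
    ring
  have hsucc : ∀ a i : Fin n, (i : ℕ) = a + 1 → window σ a < window σ i := fun a i hi => by
    by_contra hneg
    have h0 : window σ a ≠ window σ i := fun h => by
      have := abs_window_injective σ (congrArg abs h)
      rw [this] at hi
      omega
    apply h i
    zify
    rw [inv_eq_windowInv, inv_eq_windowInv, window_mul_gen_of_ne_zero _ hi,
      windowInv_comp_swap _ hi, if_neg hneg, if_pos (by omega)]
    ring
  have hge : ∀ (m : ℕ) (hm : m < n), (m : ℤ) + 1 ≤ window σ ⟨m, hm⟩ := by
    intro m
    induction m with
    | zero => exact fun hm => hzero _ rfl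
    | succ m ih =>
      intro hm
      have h1 := ih (by omega)
      have h2 := hsucc ⟨m, by omega⟩ ⟨m + 1, hm⟩ rfl
      push_cast
      omega
  have hsum : ∑ k : Fin n, ((k : ℤ) + 1) = ∑ k : Fin n, window σ k := by
    rw [← sum_abs_window σ fun t => t]
    refine Finset.sum_congr rfl fun k _ => abs_of_nonneg ?_
    have := hge k k.2
    simp only [Fin.eta] at this
    omega
  have heq := (Finset.sum_eq_sum_iff_of_le fun k _ => hge k.1 k.2).1 hsum
  apply window_injective
  funext k
  rw [window_one]
  exact (heq k (Finset.mem_univ k)).symm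

theorem inv_prod_gen_le (w : List (Fin n)) : inv (w.map gen).prod ≤ w.length := by
  -- Words grow on the right, where a generator acts on positions.
  induction w using List.reverseRecOn with
  | nil => exact inv_one.le
  | append_singleton w i ih =>
    rw [List.map_append, List.prod_append, List.map_singleton, List.prod_singleton,
      List.length_append, List.length_singleton]
    exact (inv_mul_gen_le _ i).trans (Nat.add_le_add_right ih 1)

theorem exists_word_length_eq_inv (σ : SignedPerm n) :
    ∃ w : List (Fin n), w.length = inv σ ∧ (w.map gen).prod = σ := by
  induction hm : inv σ using Nat.strong_induction_on generalizing σ with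
  | _ m ih =>
    by_cases h : ∃ i, inv (σ * gen i) + 1 = inv σ
    · obtain ⟨i, hi⟩ := h
      obtain ⟨w, hw, hprod⟩ := ih (inv (σ * gen i)) (by omega) (σ * gen i) rfl
      refine ⟨w ++ [i], ?_, ?_⟩
      · rw [List.length_append, List.length_singleton, hw, hi, hm]
      · rw [List.map_append, List.prod_append, List.map_singleton, List.prod_singleton, hprod,
          mul_gen_mul_gen]
    · have h1 := eq_one_of_forall_inv_le σ (not_exists.1 h)
      subst h1
      exact ⟨[], by rw [← hm, inv_one, List.length_nil], rfl⟩

theorem length_eq_inv (σ : SignedPerm n) : length σ = inv σ := by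
  apply le_antisymm
  · exact Nat.sInf_le (exists_word_length_eq_inv σ)
  -- Nonemptiness is needed because `sInf ∅ = 0` in `ℕ`.
  · refine le_csInf ⟨_, exists_word_length_eq_inv σ⟩ ?_
    rintro k ⟨w, rfl, rfl⟩
    exact inv_prod_gen_le w

end SignedPerm

theorem corollary4p4 (n : ℕ) (σ : SignedPerm n) :
    SignedPerm.length σ = SignedPerm.inv σ ∧
    (SignedPerm.inv σ : ℤ) =
      2 * (SignedPerm.alNest σ : ℤ) + (SignedPerm.crs σ : ℤ) + (n : ℤ)
        - (SignedPerm.wex σ : ℤ) :=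
  ⟨SignedPerm.length_eq_inv σ, SignedPerm.inv_eq σ⟩
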